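/- **Notation.** Let $\mathcal A$ be a unital associative ring and $n\ge 0$. For a square matrix $M$ over $\mathcal A$ with rows and columns labelled by finite sets, the $(i,j)$-th quasi-determinant is $$|M|_{ij}=M_{ij}-\sum_{k\ne j,\;l\ne i}M_{ik}\,\bigl((M^{ij})^{-1}\bigr)_{kl}\,M_{lj},$$ where $M^{ij}$ is $M$ with row $i$ and column $j$ removed; it is *well defined* if $M^{ij}$ is invertible. $M^{i_1,i_2,\dots}_{j_1,j_2,\dots}$ denotes the submatrix with rows $i_1,i_2,\dots$ and columns $j_1,j_2,\dots$; in a matrix composed of two blocks a bar marks the row or column index that belongs to the first block. $\overrightarrow{\prod}_{k=1}^{m}a_k=a_1a_2\cdots a_m$ and $\overleftarrow{\prod}_{k=1}^{m}a_k=a_m\cdots a_2a_1$. An *L-pair* consists of $n\times n$ matrices $L^{+},L^{-}$ over $\mathcal A$ and elements $u_0=1,u_1,\dots,u_n\in\mathcal A$ such that $L^+$ is upper triangular, $L^-$ is lower triangular, $L^{+}_{ii}=u_i$ and $L^{-}_{ii}=u_{i-1}$ for $1\le i\le n$. L-pairs $(L^{\pm(a)},u^{(a)})$ and $(\widetilde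 L^{\pm(a)},\widetilde u^{(a)})$, $a=1,2$, satisfy the *zero-curvature relations* if $$L^{+(1)}L^{+(2)}=\widetilde L^{+(2)}\widetilde L^{+(1)},\quad L^{-(1)}L^{+(2)}=\widetilde L^{+(2)}\widetilde L^{-(1)},\quad L^{-(1)}L^{-(2)}=\widetilde L^{-(2)}\widetilde L^{-(1)}. \tag{ZC}$$ **Theorem.** Let $(L^{\pm(1)},u^{(1)})$ and $(L^{\pm(2)},u^{(2)})$ be L-pairs over $\mathcal A$. Put $J=L^{-(1)}L^{+(2)}$ and $H_k=|J^{k,\dots,n}_{k,\dots,n}|_{kk}$. Consider, for $1\le i\le j\le n$, the formulas $$\widetilde L^{+(1)}_{ij}=\Bigl(\overrightarrow{\prod}_{k=1}^{i-1}H_k^{-1}u_k^{(1)}u_k^{(2)}\Bigr)H_i^{-1}\,\Bigl|\,(L^{+(1)}L^{+(2)})^{i,i+1,\dots,n}_{\bar j}\;\; J^{i,i+1,\dots,n}_{i+1,\dots,n}\Bigr|_{i\bar j},$$ $$\widetilde L^{-(1)}_{ji}=\Bigl(\overrightarrow{\prod}_{k=1}^{j-1}H_k^{-1}u_k^{(1)}u_k^{(2)}\Bigr)H_j^{-1}\,\bigl|J^{j,j+1,\dots,n}_{i,j+1,\dots,n}\bigr|_{ji},$$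 $$\widetilde L^{+(2)}_{ij}=\bigl|J^{i,j+1,\dots,n}_{j,j+1,\dots,n}\bigr|_{ij}\;\overleftarrow{\prod}_{k=1}^{j-1}(u_k^{(1)}u_k^{(2)})^{-1}H_k,$$ $$\widetilde L^{-(2)}_{ji}=\left|\begin{matrix}(L^{-(1)}L^{-(2)})^{\bar j}_{i,i+1,\dots,n}\\ J^{i+1,\dots,n}_{i,i+1,\dots,n}\end{matrix}\right|_{\bar j i}\;\overleftarrow{\prod}_{k=1}^{i-1}(u_k^{(1)}u_k^{(2)})^{-1}H_k,$$ with all remaining entries ($\widetilde L^{+(a)}$ below and $\widetilde L^{-(a)}$ above the diagonal) equal to $0$. 1. Suppose that $H_1,\dots,H_n$ are well defined and invertible and that $u_k^{(1)}u_k^{(2)}$ is invertible for $1\le k\le n-1$. Then all quasi-determinants in the formulas are well defined, the matrices $\widetilde L^{\pm(1)}$, $\widetilde L^{\pm(2)}$ given by the formulas belong to L-pairs, and these satisfy (ZC). 2. Conversely, if L-pairs $(\widetilde L^{\pm(1)},\widetilde u^{(1)})$, $(\widetilde L^{\pm(2)},\widetilde u^{(2)})$ satisfy (ZC) and all the diagonal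 entries of $\widetilde L^{-(1)}$ and of $\widetilde L^{+(2)}$ are invertible, then $H_1,\dots,H_n$ are well defined and invertible, and $\widetilde L^{\pm(1)},\widetilde L^{\pm(2)}$ are given by the formulas. 3. (Quantum Yang–Baxter map.) Let $\mathbb k$ be a field and let $q\in\mathbb k$ be nonzero and not a root of unity. Let $U=U_q(gl(n))$ be the $\mathbb k$-algebra with generators $E_{i,i+1},E_{i+1,i}$ ($1\le i<n$), $q^{\pm E_{kk}}$ ($1\le k\le n$) and its usual relations, normalised so that $[E_{i,i+1},E_{j+1,j}]=\delta_{ij}(q-q^{-1})(q^{E_{ii}-E_{i+1,i+1}}-q^{-E_{ii}+E_{i+1,i+1}})$. For $j-i\ge2$ let $E_{ij}=(q-q^{-1})^{-1}(E_{i,j-1}E_{j-1,j}-qE_{j-1,j}E_{i,j-1})$ and $E_{ji}=(q-q^{-1})^{-1}(E_{j,j-1}E_{j-1,i}-q^{-1}E_{j-1,i}E_{j,j-1})$. Let $\omega_i=E_{11}+\dots+E_{ii}$, and let $L^\pm$ be the L-pair over $U$ with $u_i=q^{2\omega_i}$, $L^+_{ij}=q^{\omega_i+\omega_j}E_{ji}$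 and $L^-_{ji}=-q^{\omega_{i-1}+\omega_{j-1}}E_{ij}$ for $i<j$. Let $C$ be any $\mathbb k$-algebra with a homomorphism $U\otimes U\to C$ (for instance a completion of $U\otimes U$), and let $L^{\pm(1)}$, $L^{\pm(2)}$ be the images in $C$ of $L^\pm\otimes1$, $1\otimes L^\pm$. Let $R\in C$ be an invertible element (for instance the universal R-matrix) for which the Yang–Baxter equations $R_{01}R_{02}R_{12}=R_{12}R_{02}R_{01}$, $R^*_{01}R_{02}R_{12}=R_{12}R_{02}R^*_{01}$, $R^*_{01}R^*_{02}R_{12}=R_{12}R^*_{02}R^*_{01}$ hold with the space $0$ evaluated in the fundamental representation, that is, $$L^{+(1)}L^{+(2)}R=R\,L^{+(2)}L^{+(1)},\quad L^{-(1)}L^{+(2)}R=R\,L^{+(2)}L^{-(1)},\quad L^{-(1)}L^{-(2)}R=R\,L^{-(2)}L^{-(1)}.$$ Then $H_1,\dots,H_n$ are well defined and invertible, and the quantum Yang–Baxter map $x\mapsto RxR^{-1}$ acts on the L-operators by the formulas: $R\,L^{\pm(a)}_{ij}R^{-1}=\widetilde L^{\pm(a)}_{ij}$ for $a=1,2$ and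 all $i,j$. -/

import Mathlib

open scoped TensorProduct

universe u v w

noncomputable section

namespace QYB

/-! ### Quasi-determinants over a noncommutative ring -/

section QuasiDet

variable {A : Type u} [Ring A]
variable {m : Type*} {p : Type*} [Fintype m] [Fintype p] [DecidableEq m] [DecidableEq p]

/-- `B` is a two-sided inverse of the matrix `M`, whose rows and columns may carry different
labels. -/
def IsInverse (M : Matrix m p A) (B : Matrix p m A) : Prop := M * B = 1 ∧ B * M = 1

open Classical in
/-- The (necessarily unique) two-sided inverse of `M`; junk value `0` if there is none. -/
def matInv (M : Matrix m p A) : Matrix p m A :=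
  if h : ∃ B, IsInverse M B then h.choose else 0

/-- The matrix `M` with row `i` and column `j` removed. -/
def removeRowCol (M : Matrix m p A) (i : m) (j : p) : Matrix {l // l ≠ i} {k // k ≠ j} A :=
  M.submatrix Subtype.val Subtype.val

/-- The `(i, j)`-th quasi-determinant of `M` is well defined: the matrix obtained from `M` by
removing row `i` and column `j` is invertible. -/
def HasQuasiDet (M : Matrix m p A) (i : m) (j : p) : Prop :=
  ∃ B, IsInverse (removeRowCol M i j) B

/-- The `(i, j)`-th quasi-determinant
`M i j - ∑ k ≠ j, ∑ l ≠ i, M i k * ((M^{ij})⁻¹) k l * M l j`. -/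
def quasiDet (M : Matrix m p A) (i : m) (j : p) : A :=
  M i j - ∑ k : {k // k ≠ j}, ∑ l : {l // l ≠ i},
    M i k * matInv (removeRowCol M i j) k l * M l j

end QuasiDet

/-! ### L-operators and the zero-curvature relations

The indices `1, …, n` of matrix entries are modelled by `Fin n` (so they are shifted by one),
while the index `k` of `u k` runs through `0, …, n`, that is, through `Fin (n + 1)`, unshifted. -/

/-- A pair of an upper triangular matrix `L⁺` and a lower triangular matrix `L⁻` with
`L⁺_{ii} = u_i`, `L⁻_{ii} = u_{i-1}` (for `1 ≤ i ≤ n`) and `u_0 = 1`. -/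
structure LPair (n : ℕ) (A : Type u) [Ring A] where
  plus : Matrix (Fin n) (Fin n) A
  minus : Matrix (Fin n) (Fin n) A
  u : Fin (n + 1) → A
  plus_upper : ∀ i j, j < i → plus i j = 0
  minus_lower : ∀ i j, i < j → minus i j = 0
  plus_diag : ∀ i, plus i i = u i.succ
  minus_diag : ∀ i, minus i i = u i.castSucc
  u_zero : u 0 = 1

/-- The image of an `LPair` under a ring homomorphism, applied to all entries. -/
def LPair.map {n : ℕ} {A : Type u} [Ring A] {B : Type v} [Ring B] (L : LPair n A) (f : A →+* B) :
    LPair n B where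
  plus := L.plus.map f
  minus := L.minus.map f
  u k := f (L.u k)
  plus_upper i j h := by simp [L.plus_upper i j h]
  minus_lower i j h := by simp [L.minus_lower i j h]
  plus_diag i := by simp [L.plus_diag i]
  minus_diag i := by simp [L.minus_diag i]
  u_zero := by simp [L.u_zero]

section Solution

variable {n : ℕ} {A : Type u} [Ring A]

/-- The zero-curvature relations
`L⁺⁽¹⁾L⁺⁽²⁾ = L̃⁺⁽²⁾L̃⁺⁽¹⁾`, `L⁻⁽¹⁾L⁺⁽²⁾ = L̃⁺⁽²⁾L̃⁻⁽¹⁾`, `L⁻⁽¹⁾L⁻⁽²⁾ = L̃⁻⁽²⁾L̃⁻⁽¹⁾`;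
here `T1`, `T2` stand for the transformed pairs. -/
def ZeroCurvature (L1 L2 T1 T2 : LPair n A) : Prop :=
  L1.plus * L2.plus = T2.plus * T1.plus ∧
  L1.minus * L2.plus = T2.plus * T1.minus ∧
  L1.minus * L2.minus = T2.minus * T1.minus

/-- `J = L⁻⁽¹⁾ L⁺⁽²⁾`. -/
def J (L1 L2 : LPair n A) : Matrix (Fin n) (Fin n) A := L1.minus * L2.plus

/-- The submatrix `J^{i,…,n}_{i,…,n}`. -/
def cornerJ (L1 L2 : LPair n A) (i : Fin n) : Matrix {k // i ≤ k} {k // i ≤ k} A :=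
  (J L1 L2).submatrix Subtype.val Subtype.val

/-- The quasi-determinant `H_i = |J^{i,…,n}_{i,…,n}|_{ii}`. -/
def H (L1 L2 : LPair n A) (i : Fin n) : A := quasiDet (cornerJ L1 L2 i) ⟨i, le_rfl⟩ ⟨i, le_rfl⟩

/-- All the quasi-determinants `H_i` are well defined and invertible. -/
def RegularJ (L1 L2 : LPair n A) : Prop :=
  ∀ i, HasQuasiDet (cornerJ L1 L2 i) ⟨i, le_rfl⟩ ⟨i, le_rfl⟩ ∧ IsUnit (H L1 L2 i)

/-- The submatrix `J^{j,j+1,…,n}_{i,j+1,…,n}`. -/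
def rowJ (L1 L2 : LPair n A) (j i : Fin n) : Matrix {k // j ≤ k} {k // k = i ∨ j < k} A :=
  (J L1 L2).submatrix Subtype.val Subtype.val

/-- The submatrix `J^{i,j+1,…,n}_{j,j+1,…,n}`. -/
def colJ (L1 L2 : LPair n A) (i j : Fin n) : Matrix {k // k = i ∨ j < k} {k // j ≤ k} A :=
  (J L1 L2).submatrix Subtype.val Subtype.val

/-- The bordered matrix `( (L⁺⁽¹⁾L⁺⁽²⁾)^{i,…,n}_{j̄}   J^{i,…,n}_{i+1,…,n} )`; the column `j̄` is
`Sum.inl ()`. -/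
def borderedPlus (L1 L2 : LPair n A) (i j : Fin n) : Matrix {k // i ≤ k} (Unit ⊕ {k // i < k}) A :=
  Matrix.fromCols ((L1.plus * L2.plus).submatrix Subtype.val fun _ => j)
    ((J L1 L2).submatrix Subtype.val Subtype.val)

/-- The bordered matrix with the row `(L⁻⁽¹⁾L⁻⁽²⁾)^{j̄}_{i,…,n}` on top of `J^{i+1,…,n}_{i,…,n}`;
the row `j̄` is `Sum.inl ()`. -/
def borderedMinus (L1 L2 : LPair n A) (j i : Fin n) : Matrix (Unit ⊕ {k // i < k}) {k // i ≤ k} A :=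
  Matrix.fromRows ((L1.minus * L2.minus).submatrix (fun _ => j) Subtype.val)
    ((J L1 L2).submatrix Subtype.val Subtype.val)

/-- The ordered product `f 0 * f 1 * ⋯ * f (i - 1)`, with indices increasing to the right. -/
def prodIncr (i : Fin n) (f : Fin n → A) : A :=
  (List.ofFn fun k : Fin (i : ℕ) => f (k.castLE i.isLt.le)).prod

/-- The ordered product `f (i - 1) * ⋯ * f 1 * f 0`, with indices decreasing to the right. -/
def prodDecr (i : Fin n) (f : Fin n → A) : A :=
  (List.ofFn fun k : Fin (i : ℕ) => f (k.castLE i.isLt.le)).reverse.prod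

/-- The product over `k = 1, …, i - 1`, from left to right, of `H_k⁻¹ u_k⁽¹⁾ u_k⁽²⁾`. -/
def leftFactor (L1 L2 : LPair n A) (i : Fin n) : A :=
  prodIncr i fun k => Ring.inverse (H L1 L2 k) * (L1.u k.succ * L2.u k.succ)

/-- The product over `k = 1, …, i - 1`, from right to left, of `(u_k⁽¹⁾ u_k⁽²⁾)⁻¹ H_k`. -/
def rightFactor (L1 L2 : LPair n A) (i : Fin n) : A :=
  prodDecr i fun k => Ring.inverse (L1.u k.succ * L2.u k.succ) * H L1 L2 k

/-- The formula for `L̃⁺⁽¹⁾`. -/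
def tildePlus1 (L1 L2 : LPair n A) : Matrix (Fin n) (Fin n) A := Matrix.of fun i j =>
  if i ≤ j then
    leftFactor L1 L2 i * Ring.inverse (H L1 L2 i) *
      quasiDet (borderedPlus L1 L2 i j) ⟨i, le_rfl⟩ (Sum.inl ())
  else 0

/-- The formula for `L̃⁻⁽¹⁾`. -/
def tildeMinus1 (L1 L2 : LPair n A) : Matrix (Fin n) (Fin n) A := Matrix.of fun j i =>
  if i ≤ j then
    leftFactor L1 L2 j * Ring.inverse (H L1 L2 j) *
      quasiDet (rowJ L1 L2 j i) ⟨j, le_rfl⟩ ⟨i, Or.inl rfl⟩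
  else 0

/-- The formula for `L̃⁺⁽²⁾`. -/
def tildePlus2 (L1 L2 : LPair n A) : Matrix (Fin n) (Fin n) A := Matrix.of fun i j =>
  if i ≤ j then
    quasiDet (colJ L1 L2 i j) ⟨i, Or.inl rfl⟩ ⟨j, le_rfl⟩ * rightFactor L1 L2 j
  else 0

/-- The formula for `L̃⁻⁽²⁾`. -/
def tildeMinus2 (L1 L2 : LPair n A) : Matrix (Fin n) (Fin n) A := Matrix.of fun j i =>
  if i ≤ j then
    quasiDet (borderedMinus L1 L2 j i) (Sum.inl ()) ⟨i, le_rfl⟩ * rightFactor L1 L2 i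
  else 0

/-- All the quasi-determinants that occur in the four formulas are well defined. -/
def QuasiDetsDefined (L1 L2 : LPair n A) : Prop := ∀ i j : Fin n, i ≤ j →
  HasQuasiDet (borderedPlus L1 L2 i j) ⟨i, le_rfl⟩ (Sum.inl ()) ∧
  HasQuasiDet (rowJ L1 L2 j i) ⟨j, le_rfl⟩ ⟨i, Or.inl rfl⟩ ∧
  HasQuasiDet (colJ L1 L2 i j) ⟨i, Or.inl rfl⟩ ⟨j, le_rfl⟩ ∧
  HasQuasiDet (borderedMinus L1 L2 j i) (Sum.inl ()) ⟨i, le_rfl⟩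

/-- The pairs `T1`, `T2` are given by the four formulas. -/
def GivenByFormulas (L1 L2 T1 T2 : LPair n A) : Prop :=
  T1.plus = tildePlus1 L1 L2 ∧ T1.minus = tildeMinus1 L1 L2 ∧
  T2.plus = tildePlus2 L1 L2 ∧ T2.minus = tildeMinus2 L1 L2

end Solution

/-! ### The quantum algebra `U_q(gl(n))` and its L-operators -/

section Quantum

/-- Generators of `U_q(gl(n))`: with all indices shifted by one, `e i`, `f i`, `K j`, `Kinv j` are
`E_{i,i+1}`, `E_{i+1,i}`, `q^{E_{jj}}`, `q^{-E_{jj}}`. -/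
inductive Gen (n : ℕ) : Type
  | e (i : Fin (n - 1))
  | f (i : Fin (n - 1))
  | K (j : Fin n)
  | Kinv (j : Fin n)

variable (k : Type u) [Field k] (q : k) (n : ℕ)

/-- A generator as an element of the free algebra. -/
def gen {n : ℕ} (x : Gen n) : FreeAlgebra k (Gen n) := FreeAlgebra.ι k x

/-- `i` as an index of a diagonal generator. -/
def lo {n : ℕ} (i : Fin (n - 1)) : Fin n := ⟨i, by omega⟩

/-- `i + 1` as an index of a diagonal generator. -/
def hi {n : ℕ} (i : Fin (n - 1)) : Fin n := ⟨i + 1, by omega⟩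

/-- `q ^ (δ_{ij} - δ_{i+1,j})`. -/
def weight {n : ℕ} (i : Fin (n - 1)) (j : Fin n) : k :=
  if j = lo i then q else if j = hi i then q⁻¹ else 1

open Gen in
/-- The defining relations of `U_q(gl(n))`, in the normalisation in which
`[E_{i,i+1}, E_{i+1,i}] = (q - q⁻¹)(q^{E_{ii}-E_{i+1,i+1}} - q^{-E_{ii}+E_{i+1,i+1}})`. -/
inductive Rel : FreeAlgebra k (Gen n) → FreeAlgebra k (Gen n) → Prop
  | K_Kinv (j) : Rel (gen k (K j) * gen k (Kinv j)) 1
  | Kinv_K (j) : Rel (gen k (Kinv j) * gen k (K j)) 1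
  | K_comm (i j) : Rel (gen k (K i) * gen k (K j)) (gen k (K j) * gen k (K i))
  | K_e (i j) : Rel (gen k (K j) * gen k (e i)) (weight k q i j • (gen k (e i) * gen k (K j)))
  | K_f (i j) : Rel (gen k (K j) * gen k (f i)) ((weight k q i j)⁻¹ • (gen k (f i) * gen k (K j)))
  | e_f (i) : Rel (gen k (e i) * gen k (f i) - gen k (f i) * gen k (e i))
      ((q - q⁻¹) • (gen k (K (lo i)) * gen k (Kinv (hi i)) -
        gen k (Kinv (lo i)) * gen k (K (hi i))))
  | e_f_ne (i j) : i ≠ j → Rel (gen k (e i) * gen k (f j)) (gen k (f j) * gen k (e i))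
  | e_far (i j : Fin (n - 1)) : (i : ℕ) + 2 ≤ j → Rel (gen k (e i) * gen k (e j)) (gen k (e j) * gen k (e i))
  | f_far (i j : Fin (n - 1)) : (i : ℕ) + 2 ≤ j → Rel (gen k (f i) * gen k (f j)) (gen k (f j) * gen k (f i))
  | e_serre (i j : Fin (n - 1)) : (i : ℕ) + 1 = j ∨ (j : ℕ) + 1 = i →
      Rel (gen k (e i) ^ 2 * gen k (e j) - (q + q⁻¹) • (gen k (e i) * gen k (e j) * gen k (e i)) +
        gen k (e j) * gen k (e i) ^ 2) 0
  | f_serre (i j : Fin (n - 1)) : (i : ℕ) + 1 = j ∨ (j : ℕ) + 1 = i →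
      Rel (gen k (f i) ^ 2 * gen k (f j) - (q + q⁻¹) • (gen k (f i) * gen k (f j) * gen k (f i)) +
        gen k (f j) * gen k (f i) ^ 2) 0

/-- The quantum algebra `U_q(gl(n))`. -/
abbrev Uq : Type u := RingQuot (Rel k q n)

/-- The image of a generator in `U_q(gl(n))`. -/
def uGen {n : ℕ} (x : Gen n) : Uq k q n := RingQuot.mkAlgHom k (Rel k q n) (gen k x)

/-- `E_{i,i+1}` (indices shifted by one); `0` if `i` is out of range. -/
def uE (i : ℕ) : Uq k q n := if h : i < n - 1 then uGen k q (Gen.e ⟨i, h⟩) else 0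

/-- `E_{i+1,i}` (indices shifted by one); `0` if `i` is out of range. -/
def uF (i : ℕ) : Uq k q n := if h : i < n - 1 then uGen k q (Gen.f ⟨i, h⟩) else 0

/-- `q^{E_{jj}}` (index shifted by one); `1` if `j` is out of range. -/
def uK (j : ℕ) : Uq k q n := if h : j < n then uGen k q (Gen.K ⟨j, h⟩) else 1

/-- `posRoot i d` is the root vector `E_{i,j}` with `j = i + d + 1` (indices shifted by one):
`E_{ij} = (q - q⁻¹)⁻¹ (E_{i,j-1} E_{j-1,j} - q E_{j-1,j} E_{i,j-1})` for `j - i ≥ 2`. -/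
def posRoot (i : ℕ) : ℕ → Uq k q n
  | 0 => uE k q n i
  | d + 1 => (q - q⁻¹)⁻¹ •
      (posRoot i d * uE k q n (i + d + 1) - q • (uE k q n (i + d + 1) * posRoot i d))

/-- `negRoot i d` is the root vector `E_{j,i}` with `j = i + d + 1` (indices shifted by one):
`E_{ji} = (q - q⁻¹)⁻¹ (E_{j,j-1} E_{j-1,i} - q⁻¹ E_{j-1,i} E_{j,j-1})` for `j - i ≥ 2`. -/
def negRoot (i : ℕ) : ℕ → Uq k q n
  | 0 => uF k q n i
  | d + 1 => (q - q⁻¹)⁻¹ •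
      (uF k q n (i + d + 1) * negRoot i d - q⁻¹ • (negRoot i d * uF k q n (i + d + 1)))

/-- `q^{ω_m}` with `ω_m = E_{11} + ⋯ + E_{mm}`. -/
def qOmega : ℕ → Uq k q n
  | 0 => 1
  | m + 1 => qOmega m * uK k q n m

/-- The L-operators of `U_q(gl(n))`: for `i < j`,
`L⁺_{ij} = q^{ω_i + ω_j} E_{ji}`, `L⁻_{ji} = - q^{ω_{i-1} + ω_{j-1}} E_{ij}`, and
`L⁺_{ii} = u_i`, `L⁻_{ii} = u_{i-1}` with `u_i = q^{2 ω_i}`. -/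
def uqL : LPair n (Uq k q n) where
  plus := Matrix.of fun i j =>
    if i < j then
      qOmega k q n (i + 1) * qOmega k q n (j + 1) * negRoot k q n i (j - i - 1)
    else if i = j then qOmega k q n (i + 1) ^ 2 else 0
  minus := Matrix.of fun j i =>
    if i < j then
      -(qOmega k q n i * qOmega k q n j * posRoot k q n i (j - i - 1))
    else if i = j then qOmega k q n i ^ 2 else 0
  u m := qOmega k q n m ^ 2
  plus_upper i j h := by simp [h.not_gt, h.ne']
  minus_lower i j h := by simp [h.not_gt, h.ne']
  plus_diag i := by simp
  minus_diag i := by simp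
  u_zero := by simp [qOmega]

variable {n} {C : Type v} [Ring C] [Algebra k C]

/-- The copy `L⁽¹⁾ = L ⊗ 1` of the L-operators in an algebra `C` that receives
`U_q(gl(n)) ⊗ U_q(gl(n))`. -/
def uqL1 (ι : Uq k q n ⊗[k] Uq k q n →ₐ[k] C) : LPair n C :=
  (uqL k q n).map (ι.comp Algebra.TensorProduct.includeLeft).toRingHom

/-- The copy `L⁽²⁾ = 1 ⊗ L` of the L-operators in `C`. -/
def uqL2 (ι : Uq k q n ⊗[k] Uq k q n →ₐ[k] C) : LPair n C :=
  (uqL k q n).map (ι.comp Algebra.TensorProduct.includeRight).toRingHom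

end Quantum

/-- Conjugation `x ↦ r x r⁻¹` by an invertible element. -/
def conj {C : Type v} [Ring C] (r : Cˣ) : C →+* C where
  toFun x := r * x * (r⁻¹ : Cˣ)
  map_one' := by simp
  map_zero' := by simp
  map_add' x y := by simp [mul_add, add_mul]
  map_mul' x y := by simp [mul_assoc]

/-- The Yang–Baxter equations `R₀₁R₀₂R₁₂ = R₁₂R₀₂R₀₁`, `R*₀₁R₀₂R₁₂ = R₁₂R₀₂R*₀₁`,
`R*₀₁R*₀₂R₁₂ = R₁₂R*₀₂R*₀₁`, with the space `0` evaluated in an `n`-dimensional representation, in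
which `R₀ₐ` and `R*₀ₐ` become the matrices `L⁺⁽ᵃ⁾` and `L⁻⁽ᵃ⁾`; `r` stands for `R₁₂`. -/
def YangBaxter {n : ℕ} {C : Type v} [Ring C] (r : C) (L1 L2 : LPair n C) : Prop :=
  L1.plus * L2.plus * Matrix.scalar (Fin n) r = Matrix.scalar (Fin n) r * (L2.plus * L1.plus) ∧
  L1.minus * L2.plus * Matrix.scalar (Fin n) r = Matrix.scalar (Fin n) r * (L2.plus * L1.minus) ∧
  L1.minus * L2.minus * Matrix.scalar (Fin n) r = Matrix.scalar (Fin n) r * (L2.minus * L1.minus)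

end QYB

end

/-! The middle relation says that $J=UV$ with $U=\widetilde L^{+(2)}$ upper and $V=\widetilde
L^{-(1)}$ lower triangular. With invertible diagonals such a Gauss decomposition is unique up to a
diagonal matrix, and the L-pair conditions fix this matrix: comparing diagonals gives
$H_i=U_{ii}V_{ii}$, $u^{(1)}_iu^{(2)}_i=U_{ii}\widetilde u^{(1)}_i$ and $V_{ii}=\widetilde
u^{(1)}_{i-1}$, hence $\widetilde u^{(1)}_i=\widetilde u^{(1)}_{i-1}H_i^{-1}u^{(1)}_iu^{(2)}_i$,
which the ordered products in the formulas solve. The outer relations then give $\widetilde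
L^{+(1)}=U^{-1}L^{+(1)}L^{+(2)}$ and $\widetilde L^{-(2)}=L^{-(1)}L^{-(2)}V^{-1}$.

Each quasi-determinant is an entry of such a product up to a diagonal factor. Since $U^{-1}J$ is
lower triangular, row $j$ of $U^{-1}$ performs the row elimination (`quasiDet_border_col`); columns
of $V^{-1}$ do the same on the other side (`quasiDet_border_row`). This settles uniqueness
(`ZeroCurvature.regularJ_and_givenByFormulas`). For existence it is enough to construct some
solution with invertible diagonals (`RegularJ.exists_zeroCurvature`): uniqueness identifies it with
the formulas. Conjugation by $R$ also yields such a solution, which gives part 3. -/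

open Matrix

namespace QYB

/-! ### Triangular matrices and their inverses. -/

section Triangular

variable {n : ℕ} {A : Type u} [Ring A]

/-- Upper triangular matrices. -/
def IsUpper (M : Matrix (Fin n) (Fin n) A) : Prop := ∀ i j, j < i → M i j = 0

/-- Lower triangular matrices. -/
def IsLower (M : Matrix (Fin n) (Fin n) A) : Prop := ∀ i j, i < j → M i j = 0

theorem IsUpper.mul {M N : Matrix (Fin n) (Fin n) A} (hM : IsUpper M) (hN : IsUpper N) :
    IsUpper (M * N) := by
  intro i j hij
  rw [mul_apply]
  refine Finset.sum_eq_zero fun k _ => ?_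
  rcases lt_or_ge k i with h | h
  · rw [hM i k h, zero_mul]
  · rw [hN k j (hij.trans_le h), mul_zero]

theorem IsLower.mul {M N : Matrix (Fin n) (Fin n) A} (hM : IsLower M) (hN : IsLower N) :
    IsLower (M * N) := by
  intro i j hij
  rw [mul_apply]
  refine Finset.sum_eq_zero fun k _ => ?_
  rcases lt_or_ge i k with h | h
  · rw [hM i k h, zero_mul]
  · rw [hN k j (h.trans_lt hij), mul_zero]

theorem IsUpper.mul_diag {M N : Matrix (Fin n) (Fin n) A} (hM : IsUpper M) (hN : IsUpper N)
    (i : Fin n) : (M * N) i i = M i i * N i i := by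
  rw [mul_apply]
  refine Finset.sum_eq_single i (fun k _ hk => ?_) (by simp)
  rcases lt_or_gt_of_ne hk with h | h
  · rw [hM i k h, zero_mul]
  · rw [hN k i h, mul_zero]

theorem IsLower.mul_diag {M N : Matrix (Fin n) (Fin n) A} (hM : IsLower M) (hN : IsLower N)
    (i : Fin n) : (M * N) i i = M i i * N i i := by
  rw [mul_apply]
  refine Finset.sum_eq_single i (fun k _ hk => ?_) (by simp)
  rcases lt_or_gt_of_ne hk with h | h
  · rw [hN k i h, mul_zero]
  · rw [hM i k h, zero_mul]

theorem IsUpper.diagonal (d : Fin n → A) : IsUpper (diagonal d) := fun _ _ h =>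
  diagonal_apply_ne _ h.ne'

theorem IsLower.diagonal (d : Fin n → A) : IsLower (diagonal d) := fun _ _ h =>
  diagonal_apply_ne _ h.ne

/-- Each factor moves at least one step to the right of the diagonal. This yields both $N^n=0$ and
the triangularity of all powers. -/
theorem strictUpper_pow_apply {N : Matrix (Fin n) (Fin n) A} (hN : ∀ i j, j ≤ i → N i j = 0)
    (m : ℕ) : ∀ i j : Fin n, (j : ℕ) < i + m → (N ^ m) i j = 0 := by
  induction m with
  | zero =>
    intro i j h
    rw [pow_zero, one_apply_ne]
    rintro rfl
    omega
  | succ m ih =>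
    intro i j h
    rw [pow_succ', mul_apply]
    refine Finset.sum_eq_zero fun k _ => ?_
    rcases le_or_gt k i with hk | hk
    · rw [hN i k hk, zero_mul]
    · rw [ih k j (by have : (i : ℕ) < k := hk; omega), mul_zero]

/-- With $D$ the diagonal part, $U=D(1-N)$ for a nilpotent $N$, and $1-N$ is inverted on both sides
by a finite geometric series. -/
theorem IsUpper.exists_inverse {U : Matrix (Fin n) (Fin n) A} (hU : IsUpper U)
    (hd : ∀ i, IsUnit (U i i)) : ∃ W, IsUpper W ∧ IsInverse U W := by
  set D : Matrix (Fin n) (Fin n) A := Matrix.diagonal fun i => U i i with hD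
  set E : Matrix (Fin n) (Fin n) A := Matrix.diagonal fun i => Ring.inverse (U i i) with hE
  have hDE : D * E = 1 := by
    rw [hD, hE, diagonal_mul_diagonal, ← diagonal_one]
    exact congrArg _ (funext fun i => Ring.mul_inverse_cancel _ (hd i))
  have hED : E * D = 1 := by
    rw [hD, hE, diagonal_mul_diagonal, ← diagonal_one]
    exact congrArg _ (funext fun i => Ring.inverse_mul_cancel _ (hd i))
  set N : Matrix (Fin n) (Fin n) A := 1 - E * U with hN
  have hN0 : ∀ i j, j ≤ i → N i j = 0 := by
    intro i j hij
    rcases hij.lt_or_eq with h | rfl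
    · rw [hN, Matrix.sub_apply, one_apply_ne h.ne', ((IsUpper.diagonal _).mul hU) i j h, sub_zero]
    · rw [hN, Matrix.sub_apply, one_apply_eq, (IsUpper.diagonal _).mul_diag hU, diagonal_apply_eq,
        Ring.inverse_mul_cancel _ (hd j), sub_self]
  have hNn : N ^ n = 0 := by
    ext i j
    exact strictUpper_pow_apply hN0 n i j (by omega)
  set S : Matrix (Fin n) (Fin n) A := ∑ m ∈ Finset.range n, N ^ m with hS
  have hSU : IsUpper S := by
    intro i j hij
    rw [hS, Matrix.sum_apply]
    exact Finset.sum_eq_zero fun m _ => strictUpper_pow_apply hN0 m i j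
      (by have : (j : ℕ) < i := hij; omega)
  have hEU : E * U = 1 - N := by rw [hN, sub_sub_cancel]
  have hUE : U = D * (1 - N) := by rw [← hEU, ← mul_assoc, hDE, one_mul]
  have h1 : (1 - N) * S = 1 := by rw [hS, mul_neg_geom_sum, hNn, sub_zero]
  have h2 : S * (1 - N) = 1 := by rw [hS, geom_sum_mul_neg, hNn, sub_zero]
  refine ⟨S * E, hSU.mul (IsUpper.diagonal _), ?_, ?_⟩
  · calc U * (S * E) = D * ((1 - N) * S) * E := by rw [hUE]; simp only [mul_assoc]
      _ = 1 := by rw [h1, mul_one, hDE]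
  · rw [mul_assoc, hEU, h2]

/-- Reversing the order of the indices exchanges lower and upper triangular matrices. -/
theorem IsLower.exists_inverse {V : Matrix (Fin n) (Fin n) A} (hV : IsLower V)
    (hd : ∀ i, IsUnit (V i i)) : ∃ W, IsLower W ∧ IsInverse V W := by
  obtain ⟨W, hW, h1, h2⟩ := IsUpper.exists_inverse (U := V.submatrix Fin.rev Fin.rev)
    (fun i j h => hV _ _ (Fin.rev_lt_rev.2 h)) fun i => hd _
  have hVV : V = (V.submatrix Fin.rev Fin.rev).submatrix Fin.revPerm Fin.revPerm := by
    ext i j; simp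
  refine ⟨W.submatrix Fin.revPerm Fin.revPerm, fun i j h => hW _ _ (Fin.rev_lt_rev.2 h), ?_, ?_⟩
  · rw [hVV, submatrix_mul_equiv, h1, submatrix_one_equiv]
  · rw [hVV, submatrix_mul_equiv, h2, submatrix_one_equiv]

end Triangular

/-! ### Quasi-determinants by elimination. -/

section QuasiDetLemmas

variable {A : Type u} [Ring A]
variable {m p s t : Type*} [Fintype m] [Fintype p] [DecidableEq m] [DecidableEq p]
  [Fintype s] [Fintype t] [DecidableEq s] [DecidableEq t]

theorem IsInverse.submatrix {N : Matrix s t A} {B : Matrix t s A} (h : IsInverse N B)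
    (er : m ≃ s) (ec : p ≃ t) : IsInverse (N.submatrix er ec) (B.submatrix ec er) := by
  constructor
  · rw [submatrix_mul_equiv, h.1, submatrix_one_equiv]
  · rw [submatrix_mul_equiv, h.2, submatrix_one_equiv]

theorem isInverse_matInv {M : Matrix m p A} (h : ∃ B, IsInverse M B) : IsInverse M (matInv M) := by
  rw [matInv, dif_pos h]
  exact h.choose_spec

/-- After removal of a row and a column, rows and columns may be relabelled. -/
theorem hasQuasiDet_iff {M : Matrix m p A} {i : m} {j : p} (er : {l // l ≠ i} ≃ s)
    (ec : {k // k ≠ j} ≃ t) (N : Matrix s t A) (h : ∀ l k, M l.1 k.1 = N (er l) (ec k)) :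
    HasQuasiDet M i j ↔ ∃ B, IsInverse N B := by
  have h1 : removeRowCol M i j = N.submatrix er ec := by
    ext l k
    exact h l k
  have h2 : N = (removeRowCol M i j).submatrix er.symm ec.symm := by
    rw [h1]; ext; simp
  constructor
  · rintro ⟨B, hB⟩
    rw [h2]
    exact ⟨_, hB.submatrix er.symm ec.symm⟩
  · rintro ⟨B, hB⟩
    refine ⟨B.submatrix ec er, ?_⟩
    rw [h1]
    exact hB.submatrix er ec

/-- If, away from column `j`, row `i` is a left combination of the other rows, the
quasi-determinant is what remains of the entry `(i, j)` when this combination is subtracted. -/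
theorem quasiDet_eq_sub_of_row {M : Matrix m p A} {i : m} {j : p} (hq : HasQuasiDet M i j)
    (ρ : {l // l ≠ i} → A) (hρ : ∀ k : {k // k ≠ j}, M i k = ∑ l, ρ l * M l.1 k) :
    quasiDet M i j = M i j - ∑ l, ρ l * M l.1 j := by
  have hB := (isInverse_matInv hq).1
  set B := matInv (removeRowCol M i j) with hBdef
  -- The coefficients are unique: right multiplication by the inverse of the reduced matrix recovers
  -- `ρ`.
  have key : (fun k : {k // k ≠ j} => M i k) ᵥ* B = ρ := by
    have : (fun k : {k // k ≠ j} => M i k) = ρ ᵥ* removeRowCol M i j := by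
      ext k
      exact hρ k
    rw [this, vecMul_vecMul, hB, vecMul_one]
  rw [quasiDet, ← hBdef, Finset.sum_comm]
  congr 1
  refine Finset.sum_congr rfl fun l _ => ?_
  rw [← Finset.sum_mul, ← congrFun key l]
  rfl

/-- If, away from row `i`, column `j` is a right combination of the other columns, the
quasi-determinant is what remains of the entry `(i, j)` when this combination is subtracted. -/
theorem quasiDet_eq_sub_of_col {M : Matrix m p A} {i : m} {j : p} (hq : HasQuasiDet M i j)
    (γ : {k // k ≠ j} → A) (hγ : ∀ l : {l // l ≠ i}, M l j = ∑ k, M l k.1 * γ k) :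
    quasiDet M i j = M i j - ∑ k, M i k.1 * γ k := by
  have hB := (isInverse_matInv hq).2
  set B := matInv (removeRowCol M i j) with hBdef
  have key : B *ᵥ (fun l : {l // l ≠ i} => M l j) = γ := by
    have : (fun l : {l // l ≠ i} => M l j) = removeRowCol M i j *ᵥ γ := by
      ext l
      exact hγ l
    rw [this, mulVec_mulVec, hB, one_mulVec]
  rw [quasiDet, ← hBdef]
  congr 1
  refine Finset.sum_congr rfl fun k _ => ?_
  rw [← congrFun key k]
  simp only [mul_assoc, ← Finset.mul_sum]
  rfl

theorem sum_subtype_eq_sum {s : Type*} [Fintype s] {P : s → Prop} [DecidablePred P] {f : s → A}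
    (h : ∀ x, ¬ P x → f x = 0) : ∑ x : {x // P x}, f x = ∑ x, f x := by
  rw [← Fintype.sum_subtype_add_sum_subtype P f, left_eq_add]
  exact Finset.sum_eq_zero fun x _ => h x x.2

theorem sum_ne_eq_sub (i : s) (f : s → A) : ∑ x : {x // x ≠ i}, f x = (∑ x, f x) - f i := by
  rw [Fintype.sum_eq_add_sum_subtype_ne f i, add_sub_cancel_left]

end QuasiDetLemmas

/-! ### Lower-right corners and Gauss decomposition. -/

section Corners

variable {n : ℕ} {A : Type u} [Ring A]

/-- The submatrix with rows and columns `j + 1, …, n`. -/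
def corner (M : Matrix (Fin n) (Fin n) A) (j : Fin n) : Matrix {k // j < k} {k // j < k} A :=
  M.submatrix Subtype.val Subtype.val

theorem corner_one (j : Fin n) : corner (1 : Matrix (Fin n) (Fin n) A) j = 1 :=
  submatrix_one _ Subtype.val_injective

/-- Rows beyond `j` of the upper triangular left factor vanish in columns up to `j`, so truncating
the inner sum loses nothing. -/
theorem IsUpper.corner_mul {M : Matrix (Fin n) (Fin n) A} (hM : IsUpper M)
    (N : Matrix (Fin n) (Fin n) A) (j : Fin n) : corner (M * N) j = corner M j * corner N j := by
  ext a b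
  simp only [corner, mul_apply, submatrix_apply]
  refine (sum_subtype_eq_sum (f := fun x => M a x * N x b) fun x hx => ?_).symm
  rw [hM _ _ ((not_lt.1 hx).trans_lt a.2), zero_mul]

theorem IsLower.corner_mul {N : Matrix (Fin n) (Fin n) A} (hN : IsLower N)
    (M : Matrix (Fin n) (Fin n) A) (j : Fin n) : corner (M * N) j = corner M j * corner N j := by
  ext a b
  simp only [corner, mul_apply, submatrix_apply]
  refine (sum_subtype_eq_sum (f := fun x => M a x * N x b) fun x hx => ?_).symm
  rw [hN _ _ ((not_lt.1 hx).trans_lt b.2), mul_zero]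

/-- The inverses of the factors are again triangular, so their corners invert the corners of the
factors. -/
theorem exists_isInverse_corner_mul {U V : Matrix (Fin n) (Fin n) A} (hU : IsUpper U)
    (hV : IsLower V) (hUd : ∀ i, IsUnit (U i i)) (hVd : ∀ i, IsUnit (V i i)) (j : Fin n) :
    ∃ B, IsInverse (corner (U * V) j) B := by
  obtain ⟨U', hU', hUU', hU'U⟩ := hU.exists_inverse hUd
  obtain ⟨V', hV', hVV', hV'V⟩ := hV.exists_inverse hVd
  refine ⟨corner V' j * corner U' j, ?_, ?_⟩
  · rw [hU.corner_mul, mul_assoc, ← mul_assoc (corner V j), ← hV'.corner_mul, hVV', corner_one,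
      one_mul, ← hU.corner_mul, hUU', corner_one]
  · rw [hU.corner_mul, mul_assoc, ← mul_assoc (corner U' j), ← hU'.corner_mul, hU'U, corner_one,
      one_mul, ← hV.corner_mul, hV'V, corner_one]

/-- Removing the least element of `{j, …, n}`. -/
def removeLeast (j : Fin n) : {x : {k // j ≤ k} // x ≠ ⟨j, le_rfl⟩} ≃ {k // j < k} where
  toFun x := ⟨x.1.1, lt_of_le_of_ne x.1.2 fun h => x.2 (Subtype.ext h.symm)⟩
  invFun k := ⟨⟨k.1, k.2.le⟩, fun h => k.2.ne' (congrArg Subtype.val h)⟩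
  left_inv _ := rfl
  right_inv _ := rfl

/-- Removing `i` from `{i, j + 1, …, n}`, where `i ≤ j`. -/
def removeExtra {i j : Fin n} (hij : i ≤ j) :
    {x : {k // k = i ∨ j < k} // x ≠ ⟨i, Or.inl rfl⟩} ≃ {k // j < k} where
  toFun x := ⟨x.1.1, x.1.2.resolve_left fun h => x.2 (Subtype.ext h)⟩
  invFun k := ⟨⟨k.1, Or.inr k.2⟩, fun h => (hij.trans_lt k.2).ne' (congrArg Subtype.val h)⟩
  left_inv _ := rfl
  right_inv _ := rfl

/-- Removing the additional label from `Unit ⊕ s`. -/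
def removeInl (s : Type*) : {x : Unit ⊕ s // x ≠ Sum.inl ()} ≃ s where
  toFun x := match x with
    | ⟨Sum.inl _, h⟩ => (h rfl).elim
    | ⟨Sum.inr k, _⟩ => k
  invFun k := ⟨Sum.inr k, by simp⟩
  left_inv x := by
    rcases x with ⟨_ | _, h⟩
    · exact (h rfl).elim
    · rfl
  right_inv _ := rfl

section

variable {p : Type*} [Fintype p] [DecidableEq p] {K W N : Matrix (Fin n) (Fin n) A} {j c : Fin n}
  {p₀ : p}

/-- A quasi-determinant of `K^{j,…,n}_{j+1,…,n}` bordered by a column of `N`, when `W` is an upper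
triangular matrix for which `W * K` is lower triangular. -/
theorem quasiDet_border_col (hW : IsUpper W) (hWK : IsLower (W * K)) {d : A} (hd : d * W j j = 1)
    {M : Matrix {k // j ≤ k} p A} (e : {x // x ≠ p₀} ≃ {k // j < k})
    (hM : ∀ r x, M r x.1 = K r (e x)) (hN : ∀ r, M r p₀ = N r c)
    (hK : ∃ B, IsInverse (corner K j) B) :
    quasiDet M ⟨j, le_rfl⟩ p₀ = d * (W * N) j c := by
  have hq : HasQuasiDet M ⟨j, le_rfl⟩ p₀ :=
    (hasQuasiDet_iff (removeLeast j) e (corner K j) fun l k => hM _ _).2 hK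
  -- The coefficients `-(d * W j l)` come from solving row `j` of `W * X` for row `j` of `X`. For `X
  -- = K` the remainder vanishes right of the diagonal, which is the elimination; for `X = N` the
  -- remainder is the value sought.
  have hsum : ∀ (X : Matrix (Fin n) (Fin n) A) (b : Fin n),
      ∑ l : {l : {k // j ≤ k} // l ≠ ⟨j, le_rfl⟩}, -(d * W j l) * X l b =
        X j b - d * (W * X) j b := by
    intro X b
    rw [sum_ne_eq_sub (⟨j, le_rfl⟩ : {k // j ≤ k}) fun l => -(d * W j l) * X l b,
      sum_subtype_eq_sum (f := fun l => -(d * W j l) * X l b) fun x hx => by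
        rw [hW _ _ (not_le.1 hx), mul_zero, neg_zero, zero_mul], hd, mul_apply, Finset.mul_sum]
    simp only [neg_mul, one_mul, Finset.sum_neg_distrib, mul_assoc]
    abel
  rw [quasiDet_eq_sub_of_row hq fun l => -(d * W j l)]
  · simp only [hN, hsum]
    abel
  · intro k
    simp only [hM, hsum, hWK _ _ (e k).2, mul_zero, sub_zero]

/-- A quasi-determinant of `K^{j+1,…,n}_{j,…,n}` bordered by a row of `N`, when `W` is a lower
triangular matrix for which `K * W` is upper triangular. -/
theorem quasiDet_border_row (hW : IsLower W) (hKW : IsUpper (K * W)) {d : A} (hd : W j j * d = 1)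
    {M : Matrix p {k // j ≤ k} A} (e : {x // x ≠ p₀} ≃ {k // j < k})
    (hM : ∀ x r, M x.1 r = K (e x) r) (hN : ∀ r, M p₀ r = N c r)
    (hK : ∃ B, IsInverse (corner K j) B) :
    quasiDet M p₀ ⟨j, le_rfl⟩ = (N * W) c j * d := by
  have hq : HasQuasiDet M p₀ ⟨j, le_rfl⟩ :=
    (hasQuasiDet_iff e (removeLeast j) (corner K j) fun l k => hM _ _).2 hK
  have hsum : ∀ (X : Matrix (Fin n) (Fin n) A) (b : Fin n),
      ∑ l : {l : {k // j ≤ k} // l ≠ ⟨j, le_rfl⟩}, X b l * -(W l j * d) =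
        X b j - (X * W) b j * d := by
    intro X b
    rw [sum_ne_eq_sub (⟨j, le_rfl⟩ : {k // j ≤ k}) fun l => X b l * -(W l j * d),
      sum_subtype_eq_sum (f := fun l => X b l * -(W l j * d)) fun x hx => by
        rw [hW _ _ (not_le.1 hx), zero_mul, neg_zero, mul_zero], hd, mul_apply, Finset.sum_mul]
    simp only [mul_neg, mul_one, Finset.sum_neg_distrib, mul_assoc]
    abel
  rw [quasiDet_eq_sub_of_col hq fun l => -(W l j * d)]
  · simp only [hN, hsum]
    abel
  · intro k
    simp only [hM, hsum, hKW _ _ (e k).2, zero_mul, sub_zero]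

end

/-- The upper unitriangular factor of the Gauss decomposition. -/
theorem exists_upper_mul_isLower {K : Matrix (Fin n) (Fin n) A}
    (hK : ∀ j, ∃ B, IsInverse (corner K j) B) :
    ∃ W, IsUpper W ∧ (∀ i, W i i = 1) ∧ IsLower (W * K) := by
  choose B hB using hK
  -- The combination of the rows below `i` that agrees with row `i` to the right of the diagonal;
  -- `W` subtracts it.
  let ρ : ∀ i : Fin n, {l // i < l} → A := fun i =>
    (fun k : {k // i < k} => K i k) ᵥ* B i
  let W : Matrix (Fin n) (Fin n) A := Matrix.of fun i l =>
    if h : i < l then -ρ i ⟨l, h⟩ else if i = l then 1 else 0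
  have hρ : ∀ i (k : {k // i < k}), ∑ l, ρ i l * K l k = K i k := by
    intro i k
    have : ρ i ᵥ* corner K i = fun k : {k // i < k} => K i k := by
      simp only [ρ]
      rw [vecMul_vecMul, (hB i).2, vecMul_one]
    exact congrFun this k
  have hW : IsUpper W := fun i j h => by simp [W, h.not_gt, h.ne']
  have hWd : ∀ i, W i i = 1 := fun i => by simp [W]
  refine ⟨W, hW, hWd, fun i k hik => ?_⟩
  rw [mul_apply, ← sum_subtype_eq_sum (P := fun l => i ≤ l) fun l hl => by
      rw [hW _ _ (not_le.1 hl), zero_mul],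
    Fintype.sum_eq_add_sum_subtype_ne _ (⟨i, le_rfl⟩ : {l // i ≤ l}),
    ← (removeLeast i).symm.sum_comp, hWd, one_mul]
  have : ∀ l : {l // i < l}, W i l = -ρ i l := fun l => by simp [W, l.2]
  change K i k + ∑ l : {l // i < l}, W i l * K l k = 0
  simp only [this, neg_mul, Finset.sum_neg_distrib]
  rw [hρ i ⟨k, hik⟩, add_neg_cancel]

end Corners

/-! ### Ordered products as solutions of recursions. -/

section Products

variable {n : ℕ} {A : Type u} [Ring A]

/-- The product stops before `i`, so the recursion is never needed at the last index, where
invertibility may fail. -/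
theorem prodIncr_eq {f : Fin n → A} {g : Fin (n + 1) → A} (h0 : g 0 = 1)
    (hs : ∀ i : Fin n, (i : ℕ) + 1 < n → g i.succ = g i.castSucc * f i) (i : Fin n) :
    prodIncr i f = g i.castSucc := by
  obtain ⟨i, hi⟩ := i
  induction i with
  | zero => simpa [prodIncr] using h0.symm
  | succ i ih =>
    have h1 := ih (by omega)
    have h2 := hs ⟨i, by omega⟩ hi
    simp only [prodIncr] at h1 ⊢
    rw [List.ofFn_succ', List.concat_eq_append, List.prod_append, List.prod_singleton]
    exact (congrArg (· * f ⟨i, by omega⟩) h1).trans h2.symm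

theorem prodDecr_eq {f : Fin n → A} {g : Fin (n + 1) → A} (h0 : g 0 = 1)
    (hs : ∀ i : Fin n, (i : ℕ) + 1 < n → g i.succ = f i * g i.castSucc) (i : Fin n) :
    prodDecr i f = g i.castSucc := by
  obtain ⟨i, hi⟩ := i
  induction i with
  | zero => simpa [prodDecr] using h0.symm
  | succ i ih =>
    have h1 := ih (by omega)
    have h2 := hs ⟨i, by omega⟩ hi
    simp only [prodDecr] at h1 ⊢
    rw [List.ofFn_succ', List.concat_eq_append, List.reverse_append, List.prod_append,
      List.reverse_singleton, List.prod_singleton]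
    exact (congrArg (f ⟨i, by omega⟩ * ·) h1).trans h2.symm

theorem inverse_mul {M : Type*} [MonoidWithZero M] {a b : M} (ha : IsUnit a) (hb : IsUnit b) :
    Ring.inverse (a * b) = Ring.inverse b * Ring.inverse a := by
  obtain ⟨a, rfl⟩ := ha
  obtain ⟨b, rfl⟩ := hb
  rw [← Units.val_mul]
  rw [Ring.inverse_unit, Ring.inverse_unit, Ring.inverse_unit, _root_.mul_inv_rev, Units.val_mul]

end Products

/-! ### Uniqueness and existence for the zero-curvature relations. -/

section Solution

variable {n : ℕ} {A : Type u} [Ring A] {L1 L2 T1 T2 : LPair n A}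

theorem hasQuasiDet_cornerJ_iff (i : Fin n) :
    HasQuasiDet (cornerJ L1 L2 i) ⟨i, le_rfl⟩ ⟨i, le_rfl⟩ ↔
      ∃ B, IsInverse (corner (J L1 L2) i) B :=
  hasQuasiDet_iff (removeLeast i) (removeLeast i) _ fun _ _ => rfl

theorem borderedPlus_apply (i j : Fin n) (r : {k // i ≤ k}) (x : {x // x ≠ Sum.inl ()}) :
    borderedPlus L1 L2 i j r x.1 = J L1 L2 r (removeInl {k // i < k} x) := by
  rcases x with ⟨_ | x, hx⟩
  · exact (hx rfl).elim
  · rfl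

theorem borderedMinus_apply (j i : Fin n) (x : {x // x ≠ Sum.inl ()}) (r : {k // i ≤ k}) :
    borderedMinus L1 L2 j i x.1 r = J L1 L2 (removeInl {k // i < k} x) r := by
  rcases x with ⟨_ | x, hx⟩
  · exact (hx rfl).elim
  · rfl

/-- Deleting the distinguished row and column always leaves a corner of `J`, the same one that
occurs for some $H_k$. -/
theorem RegularJ.quasiDetsDefined (h : RegularJ L1 L2) : QuasiDetsDefined L1 L2 := by
  have hc := fun i => (hasQuasiDet_cornerJ_iff i).1 (h i).1
  exact fun i j hij =>
    ⟨(hasQuasiDet_iff (removeLeast i) (removeInl _) _ fun _ _ => borderedPlus_apply ..).2 (hc i),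
      (hasQuasiDet_iff (removeLeast j) (removeExtra hij) _ fun _ _ => rfl).2 (hc j),
      (hasQuasiDet_iff (removeExtra hij) (removeLeast j) _ fun _ _ => rfl).2 (hc j),
      (hasQuasiDet_iff (removeInl _) (removeLeast i) _ fun _ _ => borderedMinus_apply ..).2 (hc i)⟩

theorem ZeroCurvature.regularJ_and_givenByFormulas (hZ : ZeroCurvature L1 L2 T1 T2)
    (hV : ∀ i, IsUnit (T1.minus i i)) (hU : ∀ i, IsUnit (T2.plus i i)) :
    RegularJ L1 L2 ∧ GivenByFormulas L1 L2 T1 T2 := by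
  obtain ⟨hP, hJ, hQ⟩ := hZ
  have hUup : IsUpper T2.plus := T2.plus_upper
  have hVlo : IsLower T1.minus := T1.minus_lower
  obtain ⟨U', hU', hUU', hU'U⟩ := hUup.exists_inverse hU
  obtain ⟨V', hV', hVV', hV'V⟩ := hVlo.exists_inverse hV
  have hc : ∀ j, ∃ B, IsInverse (corner (J L1 L2) j) B := fun j => by
    rw [J, hJ]
    exact exists_isInverse_corner_mul hUup hVlo hU hV j
  have hUJ : U' * J L1 L2 = T1.minus := by rw [J, hJ, ← mul_assoc, hU'U, one_mul]
  have hJV : J L1 L2 * V' = T2.plus := by rw [J, hJ, mul_assoc, hVV', mul_one]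
  have hUd : ∀ j, T2.plus j j * U' j j = 1 := fun j => by
    rw [← hUup.mul_diag hU', hUU', one_apply_eq]
  have hVd : ∀ j, V' j j * T1.minus j j = 1 := fun j => by
    rw [← hV'.mul_diag hVlo, hV'V, one_apply_eq]
  -- Elimination with $W=U^{-1}$, $d=U_{ii}$ and $U^{-1}J=V$.
  have hH : ∀ i, H L1 L2 i = T2.plus i i * T1.minus i i := fun i => by
    rw [← hUJ]
    exact quasiDet_border_col hU' (hUJ ▸ hVlo) (hUd i) (removeLeast i) (fun _ _ => rfl)
      (fun _ => rfl) (hc i)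
  have hHu : ∀ i, IsUnit (H L1 L2 i) := fun i => hH i ▸ (hU i).mul (hV i)
  have hu : ∀ i : Fin n, L1.u i.succ * L2.u i.succ = T2.plus i i * T1.u i.succ := fun i => by
    have := congrFun (congrFun hP i) i
    rwa [IsUpper.mul_diag L1.plus_upper L2.plus_upper, IsUpper.mul_diag hUup T1.plus_upper,
      L1.plus_diag, L2.plus_diag, T1.plus_diag] at this
  have hHinv : ∀ i, Ring.inverse (H L1 L2 i) =
      Ring.inverse (T1.minus i i) * Ring.inverse (T2.plus i i) := fun i => by
    rw [hH, inverse_mul (hU i) (hV i)]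
  have hl : ∀ i, leftFactor L1 L2 i = T1.minus i i := fun i => by
    rw [T1.minus_diag]
    refine prodIncr_eq T1.u_zero (fun i _ => ?_) i
    rw [hHinv, hu, ← T1.minus_diag, mul_assoc, Ring.inverse_mul_cancel_left _ _ (hU i),
      Ring.mul_inverse_cancel_left _ _ (hV i)]
  have hr : ∀ i, rightFactor L1 L2 i = Ring.inverse (T1.minus i i) := fun i => by
    rw [T1.minus_diag]
    -- Below the last index, `T1.u i.succ` is the next diagonal entry of `T1.minus`, hence a unit;
    -- `T1.u` at the top index need not be one.
    refine prodDecr_eq (g := fun k => Ring.inverse (T1.u k)) (by simp [T1.u_zero])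
      (fun i hi => ?_) i
    have h1 : IsUnit (T1.u i.succ) := by
      have := hV ⟨i + 1, hi⟩
      rwa [T1.minus_diag] at this
    rw [hu, hH, inverse_mul (hU i) h1, mul_assoc, mul_assoc, mul_assoc,
      Ring.inverse_mul_cancel_left _ _ (hU i), ← T1.minus_diag,
      Ring.mul_inverse_cancel _ (hV i), mul_one]
  have hleft : ∀ i a, leftFactor L1 L2 i * Ring.inverse (H L1 L2 i) * (T2.plus i i * a) = a :=
    fun i a => by
      rw [hl, hHinv, Ring.mul_inverse_cancel_left _ _ (hV i),
        Ring.inverse_mul_cancel_left _ _ (hU i)]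
  have hright : ∀ i a, a * T1.minus i i * rightFactor L1 L2 i = a := fun i a => by
    rw [hr, Ring.mul_inverse_cancel_right _ _ (hV i)]
  refine ⟨fun i => ⟨(hasQuasiDet_cornerJ_iff i).2 (hc i), hHu i⟩, ?_, ?_, ?_, ?_⟩
  · ext i j
    rw [tildePlus1, of_apply]
    split_ifs with hij
    · rw [quasiDet_border_col (N := L1.plus * L2.plus) (c := j) hU' (hUJ ▸ hVlo) (hUd i)
        (removeInl _) (borderedPlus_apply i j) (fun _ => rfl) (hc i), hleft, hP, ← mul_assoc,
        hU'U, one_mul]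
    · exact T1.plus_upper i j (not_le.1 hij)
  · ext j i
    rw [tildeMinus1, of_apply]
    split_ifs with hij
    · rw [quasiDet_border_col (N := J L1 L2) (c := i) hU' (hUJ ▸ hVlo) (hUd j)
        (removeExtra hij) (fun _ _ => rfl) (fun _ => rfl) (hc j), hleft, hUJ]
    · exact T1.minus_lower j i (not_le.1 hij)
  · ext i j
    rw [tildePlus2, of_apply]
    split_ifs with hij
    · rw [quasiDet_border_row (N := J L1 L2) (c := i) hV' (hJV ▸ hUup) (hVd j)
        (removeExtra hij) (fun _ _ => rfl) (fun _ => rfl) (hc j), hright, hJV]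
    · exact T2.plus_upper i j (not_le.1 hij)
  · ext j i
    rw [tildeMinus2, of_apply]
    split_ifs with hij
    · rw [quasiDet_border_row (N := L1.minus * L2.minus) (c := j) hV' (hJV ▸ hUup) (hVd i)
        (removeInl _) (borderedMinus_apply j i) (fun _ => rfl) (hc i), hright, hQ, mul_assoc,
        hVV', mul_one]
    · exact T2.minus_lower j i (not_le.1 hij)

theorem RegularJ.exists_zeroCurvature (h : RegularJ L1 L2)
    (hu : ∀ k : Fin (n + 1), 0 < k → k < Fin.last n → IsUnit (L1.u k * L2.u k)) :
    ∃ T1 T2 : LPair n A, ZeroCurvature L1 L2 T1 T2 ∧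
      (∀ i, IsUnit (T1.minus i i)) ∧ ∀ i, IsUnit (T2.plus i i) := by
  have hc := fun i => (hasQuasiDet_cornerJ_iff i).1 (h i).1
  obtain ⟨W, hW, hWd, hWJ⟩ := exists_upper_mul_isLower hc
  obtain ⟨W', hW', hWW', hW'W⟩ := hW.exists_inverse fun i => hWd i ▸ isUnit_one
  have hW'd : ∀ i, W' i i = 1 := fun i => by
    rw [← one_mul (W' i i), ← hWd i, ← hW.mul_diag hW', hWW', one_apply_eq, hWd]
  set η := H L1 L2
  have hη : ∀ i, IsUnit (η i) := fun i => (h i).2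
  have hWJd : ∀ i, (W * J L1 L2) i i = η i := fun i => by
    rw [← one_mul ((W * J L1 L2) i i)]
    exact (quasiDet_border_col hW hWJ (by rw [hWd, mul_one]) (removeLeast i) (fun _ _ => rfl)
      (fun _ => rfl) (hc i)).symm
  -- The future `T1.u`, defined by the recursion that the diagonal of the first relation forces.
  let g : Fin (n + 1) → A :=
    Fin.induction 1 fun i x => x * (Ring.inverse (η i) * (L1.u i.succ * L2.u i.succ))
  have g0 : g 0 = 1 := rfl
  have gs : ∀ i : Fin n,
      g i.succ = g i.castSucc * (Ring.inverse (η i) * (L1.u i.succ * L2.u i.succ)) := fun i => by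
    simp only [g, Fin.induction_succ]
  have hg' : ∀ k : Fin (n + 1), k < Fin.last n → IsUnit (g k) := by
    intro k
    induction k using Fin.induction with
    | zero => exact fun _ => g0 ▸ isUnit_one
    | succ i ih =>
      intro hi
      rw [gs]
      exact (ih i.castSucc_lt_last).mul ((hη i).ringInverse.mul (hu _ i.succ_pos hi))
  have hg : ∀ i : Fin n, IsUnit (g i.castSucc) := fun i => hg' _ i.castSucc_lt_last
  -- The diagonal part `η` of the Gauss decomposition is split between the factors so that `V` gets
  -- the diagonal `g`.
  let U : Matrix (Fin n) (Fin n) A :=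
    W' * diagonal fun i => η i * Ring.inverse (g i.castSucc)
  let V : Matrix (Fin n) (Fin n) A :=
    (diagonal fun i => g i.castSucc * Ring.inverse (η i)) * (W * J L1 L2)
  have hU : IsUpper U := hW'.mul (IsUpper.diagonal _)
  have hV : IsLower V := (IsLower.diagonal _).mul hWJ
  have hUd : ∀ i, U i i = η i * Ring.inverse (g i.castSucc) := fun i => by
    simp only [U]
    rw [hW'.mul_diag (IsUpper.diagonal _), hW'd, one_mul, diagonal_apply_eq]
  have hVd : ∀ i, V i i = g i.castSucc := fun i => by
    simp only [V]
    rw [(IsLower.diagonal _).mul_diag hWJ, diagonal_apply_eq, hWJd,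
      Ring.inverse_mul_cancel_right _ _ (hη i)]
  have hUu : ∀ i, IsUnit (U i i) := fun i => hUd i ▸ (hη i).mul (hg i).ringInverse
  have hVu : ∀ i, IsUnit (V i i) := fun i => hVd i ▸ hg i
  have hUV : J L1 L2 = U * V := by
    have : (diagonal fun i => η i * Ring.inverse (g i.castSucc)) *
        (diagonal fun i => g i.castSucc * Ring.inverse (η i)) =
        (1 : Matrix (Fin n) (Fin n) A) := by
      rw [diagonal_mul_diagonal, ← diagonal_one]
      refine congrArg _ (funext fun i => ?_)
      rw [mul_assoc, Ring.inverse_mul_cancel_left _ _ (hg i), Ring.mul_inverse_cancel _ (hη i)]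
    simp only [U, V]
    rw [mul_assoc, ← mul_assoc (diagonal _), this, one_mul, ← mul_assoc, hW'W, one_mul]
  obtain ⟨U', hU', hUU', hU'U⟩ := hU.exists_inverse hUu
  obtain ⟨V', hV', hVV', hV'V⟩ := hV.exists_inverse hVu
  have hU'd : ∀ i, U' i i = g i.castSucc * Ring.inverse (η i) := fun i => by
    have h1 : U i i * U' i i = 1 := by rw [← hU.mul_diag hU', hUU', one_apply_eq]
    rw [← Ring.inverse_mul_cancel_left _ (U' i i) (hUu i), h1, mul_one, hUd,
      inverse_mul (hη i) (hg i).ringInverse, Ring.inverse_inverse (hg i)]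
  have hV'd : ∀ i, V' i i = Ring.inverse (g i.castSucc) := fun i => by
    have h1 : V i i * V' i i = 1 := by rw [← hV.mul_diag hV', hVV', one_apply_eq]
    rw [← Ring.inverse_mul_cancel_left _ (V' i i) (hVu i), h1, mul_one, hVd]
  have hP : IsUpper (L1.plus * L2.plus) := IsUpper.mul L1.plus_upper L2.plus_upper
  have hQ : IsLower (L1.minus * L2.minus) := IsLower.mul L1.minus_lower L2.minus_lower
  refine ⟨{ plus := U' * (L1.plus * L2.plus)
            minus := V
            u := g
            plus_upper := hU'.mul hP
            minus_lower := hV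
            plus_diag := fun i => ?_
            minus_diag := hVd
            u_zero := g0 },
          { plus := U
            minus := L1.minus * L2.minus * V'
            -- Forced by `plus_diag` and `u_zero`; that `minus_diag` agrees with it is the remaining
            -- consistency check.
            u := Fin.cases 1 fun i => U i i
            plus_upper := hU
            minus_lower := hQ.mul hV'
            plus_diag := fun i => by simp
            minus_diag := fun i => ?_
            u_zero := rfl }, ⟨?_, hUV, ?_⟩, hVu, hUu⟩
  · rw [hU'.mul_diag hP, IsUpper.mul_diag L1.plus_upper L2.plus_upper, L1.plus_diag,
      L2.plus_diag, hU'd, gs, mul_assoc]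
  · rw [hQ.mul_diag hV', IsLower.mul_diag L1.minus_lower L2.minus_lower, L1.minus_diag,
      L2.minus_diag, hV'd]
    -- At index `0` every factor is `1`. At a later index, inverting the recursion for `g` produces
    -- the inverse of `L1.u * L2.u`, which cancels; this index is below the last one, where the
    -- product is a unit.
    have hi := i.castSucc_lt_last
    generalize i.castSucc = k at hi
    cases k using Fin.cases with
    | zero => simp [g0, L1.u_zero, L2.u_zero]
    | succ k =>
      have hk := hu _ k.succ_pos hi
      rw [Fin.cases_succ, hUd, gs, inverse_mul (hg k) ((hη k).ringInverse.mul hk),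
        inverse_mul (hη k).ringInverse hk, Ring.inverse_inverse (hη k), mul_assoc (Ring.inverse _),
        Ring.mul_inverse_cancel_left _ _ hk]
  · rw [← mul_assoc, hUU', one_mul]
  · rw [mul_assoc, hV'V, mul_one]

end Solution

/-! ### The quantum Yang–Baxter map as a zero-curvature solution. -/

section YangBaxterMap

/-- Moving `r` to the other side turns each Yang–Baxter equation into an entrywise conjugation,
which is multiplicative. -/
theorem YangBaxter.zeroCurvature {n : ℕ} {C : Type v} [Ring C] {r : Cˣ} {L1 L2 : LPair n C}
    (h : YangBaxter (r : C) L1 L2) :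
    ZeroCurvature L1 L2 (L1.map (conj r)) (L2.map (conj r)) := by
  have key : ∀ X Y : Matrix (Fin n) (Fin n) C,
      X * Matrix.scalar (Fin n) (r : C) = Matrix.scalar (Fin n) (r : C) * Y →
      X = Y.map (conj r) := by
    intro X Y h
    ext i j
    have := congrFun (congrFun h i) j
    rw [scalar_apply, mul_diagonal, diagonal_mul] at this
    rw [map_apply]
    exact (Units.eq_mul_inv_iff_mul_eq r).2 this
  obtain ⟨h1, h2, h3⟩ := h
  refine ⟨?_, ?_, ?_⟩
  · exact (key _ _ h1).trans Matrix.map_mul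
  · exact (key _ _ h2).trans Matrix.map_mul
  · exact (key _ _ h3).trans Matrix.map_mul

variable (k : Type u) [Field k] (q : k) (n : ℕ)

theorem isUnit_uK (j : ℕ) : IsUnit (uK k q n j) := by
  rw [uK]
  split_ifs with h
  · have h1 := RingQuot.mkAlgHom_rel k (Rel.K_Kinv (k := k) (q := q) ⟨j, h⟩)
    have h2 := RingQuot.mkAlgHom_rel k (Rel.Kinv_K (k := k) (q := q) ⟨j, h⟩)
    rw [map_mul, map_one] at h1 h2
    exact ⟨⟨_, _, h1, h2⟩, rfl⟩
  · exact isUnit_one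

theorem isUnit_qOmega (m : ℕ) : IsUnit (qOmega k q n m) := by
  induction m with
  | zero => exact isUnit_one
  | succ m ih => exact ih.mul (isUnit_uK k q n m)

/-- Supplies the invertible diagonals that uniqueness requires, since ring homomorphisms preserve
units. -/
theorem isUnit_uqL_u (m : Fin (n + 1)) : IsUnit ((uqL k q n).u m) :=
  (isUnit_qOmega k q n m).pow 2

end YangBaxterMap

end QYB

theorem theorem2p3 {n : ℕ} {A : Type u} [Ring A] (L1 L2 : QYB.LPair n A) :
    -- the formulas solve the zero-curvature relations
    (QYB.RegularJ L1 L2 →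
      (∀ k : Fin (n + 1), 0 < k → k < Fin.last n → IsUnit (L1.u k * L2.u k)) →
      QYB.QuasiDetsDefined L1 L2 ∧
      ∃ T1 T2 : QYB.LPair n A,
        QYB.GivenByFormulas L1 L2 T1 T2 ∧ QYB.ZeroCurvature L1 L2 T1 T2) ∧
    -- there is no other solution with invertible diagonals
    (∀ T1 T2 : QYB.LPair n A, QYB.ZeroCurvature L1 L2 T1 T2 →
      (∀ i, IsUnit (T1.minus i i) ∧ IsUnit (T2.plus i i)) →
      QYB.RegularJ L1 L2 ∧ QYB.GivenByFormulas L1 L2 T1 T2) ∧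
    -- for `U_q(gl(n))` this is the quantum Yang-Baxter map
    (∀ {k : Type v} [Field k] (q : k), q ≠ 0 → (∀ m : ℕ, 0 < m → q ^ m ≠ 1) →
      ∀ {C : Type w} [Ring C] [Algebra k C] (ι : QYB.Uq k q n ⊗[k] QYB.Uq k q n →ₐ[k] C) (r : Cˣ),
        QYB.YangBaxter (r : C) (QYB.uqL1 k q ι) (QYB.uqL2 k q ι) →
        QYB.RegularJ (QYB.uqL1 k q ι) (QYB.uqL2 k q ι) ∧
        QYB.GivenByFormulas (QYB.uqL1 k q ι) (QYB.uqL2 k q ι)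
          ((QYB.uqL1 k q ι).map (QYB.conj r)) ((QYB.uqL2 k q ι).map (QYB.conj r))) := by
  refine ⟨fun h hu => ⟨h.quasiDetsDefined, ?_⟩,
    fun T1 T2 hZ hd => hZ.regularJ_and_givenByFormulas (fun i => (hd i).1) fun i => (hd i).2,
    fun {k} _ q _ _ {C} _ _ ι r hr => hr.zeroCurvature.regularJ_and_givenByFormulas
      (fun i => ?_) fun i => ?_⟩
  -- Any solution with invertible diagonals will do: uniqueness shows that the formulas give it.
  · obtain ⟨T1, T2, hZ, hV, hU⟩ := h.exists_zeroCurvature hu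
    exact ⟨T1, T2, (hZ.regularJ_and_givenByFormulas hV hU).2, hZ⟩
  · rw [QYB.LPair.minus_diag]
    exact ((QYB.isUnit_uqL_u k q n _).map _).map (QYB.conj r)
  · rw [QYB.LPair.plus_diag]
    exact ((QYB.isUnit_uqL_u k q n _).map _).map (QYB.conj r)
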